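/- **Theorem.** Let $k\ge 3$ be an integer, let $A_j=\big(\sin\frac{\pi(2j-3)}{k},-\cos\frac{\pi(2j-3)}{k}\big)$, $1\le j\le k$, be the vertices of a regular $k$-gon inscribed in the unit circle of $\mathbb R^2$, let $L$ be its boundary (the union of its $k$ sides, each of length $2\sin\frac{\pi}{k}$), and let $\beta=\{A_1,\dots,A_k\}$. For a finite Borel measure $P$ on $L$ and $n\ge k$ let $$V_n(P)=\inf\Big\{\int \min_{a\in\alpha\cup\beta}\|x-a\|^2\,dP(x)\;:\;\alpha\subseteq\mathbb R^2,\ \operatorname{card}(\alpha)\le n-k\Big\}$$ be the $n$th conditional quantization error of $P$ with respect to the conditional set $\beta$. If $(V_n(P))_{n\ge k}$ is strictly decreasing with limit $V_\infty(P)$, the conditional quantization dimension of $P$ is $D(P)=\lim_{n\to\infty}\frac{2\log n}{-\log(V_n(P)-V_\infty(P))}$, if this limit exists, and for $\kappa>0$ the $\kappa$-dimensional conditional quantization coefficient of $P$ is $\lim_{n\to\infty}n^{2/\kappa}(V_n(P)-V_\infty(P))$, if this limit exists. (a) Let $P$ be the uniform distribution on $L$ with constant density $\frac1k$ with respect to arc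 length (its total mass is $2\sin\frac{\pi}{k}$, so it is a probability measure only for $k=6$). Then $(V_n(P))_{n\ge k}$ is strictly decreasing, the conditional quantization dimension $D(P)$ exists and equals $1$, and the $1$-dimensional conditional quantization coefficient $\lim_{n\to\infty}n^2(V_n(P)-V_\infty(P))$ exists as a finite positive number and equals $\frac23k^2\sin^3\frac{\pi}{k}$. (b) Let $P$ be the uniform probability distribution on $L$, that is, arc length divided by the perimeter $2k\sin\frac{\pi}{k}$. Then $(V_n(P))_{n\ge k}$ is strictly decreasing, $D(P)$ exists and equals $1$, and the $1$-dimensional conditional quantization coefficient exists as a finite positive number and equals $\frac13k^2\sin^2\frac{\pi}{k}$. -/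

import Mathlib

open MeasureTheory Filter Topology

noncomputable section

namespace CondQuantization

/-- The Euclidean plane. -/
abbrev Plane : Type := EuclideanSpace ℝ (Fin 2)

/-- The distortion error `∫ min_{a ∈ γ} d(x, a)² dP(x)`. For a nonempty finite `γ` the distance
`Metric.infDist x γ` is the minimum of `d(x, a)` over `a ∈ γ`. -/
def distortion (P : Measure Plane) (γ : Set Plane) : ℝ :=
  ∫ x, (Metric.infDist x γ) ^ 2 ∂P

/-- The `n`th conditional (unconstrained) quantization error of `P` with respect to the conditional
set `β`: the infimum of the distortion errors of `α ∪ β`, over all sets `α` in the plane with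
`card α ≤ n - card β`. It is meant for finite nonempty `β` and `n ≥ card β`. -/
def condError (P : Measure Plane) (β : Set Plane) (n : ℕ) : ℝ :=
  sInf {v : ℝ | ∃ α : Set Plane, α.encard + β.encard ≤ (n : ℕ∞) ∧ v = distortion P (α ∪ β)}

/-- The conditional quantization dimension of `P` exists and equals `D`: the errors `V n` are
strictly decreasing for `n ≥ card β`, they converge to some `Vinf`, and
`2 log n / (- log (V n - Vinf))` tends to `D`. -/
def HasCondQuantDim (P : Measure Plane) (β : Set Plane) (D : ℝ) : Prop :=
  StrictAntiOn (condError P β) {n : ℕ | β.encard ≤ (n : ℕ∞)} ∧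
  ∃ Vinf : ℝ, Tendsto (condError P β) atTop (𝓝 Vinf) ∧
    Tendsto (fun n : ℕ => 2 * Real.log n / (-Real.log (condError P β n - Vinf))) atTop (𝓝 D)

/-- The `κ`-dimensional conditional quantization coefficient of `P` exists (as a finite number)
and equals `c`: the errors `V n` converge to some `Vinf`, and `n ^ (2 / κ) * (V n - Vinf)` tends
to `c`. -/
def HasCondQuantCoeff (P : Measure Plane) (β : Set Plane) (κ c : ℝ) : Prop :=
  ∃ Vinf : ℝ, Tendsto (condError P β) atTop (𝓝 Vinf) ∧
    Tendsto (fun n : ℕ => (n : ℝ) ^ (2 / κ) * (condError P β n - Vinf)) atTop (𝓝 c)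

/-- The vertex `A_j` of the regular `k`-gon inscribed in the unit circle; `A_(k+1) = A_1`. -/
def vertex (k j : ℕ) : Plane :=
  !₂[Real.sin (Real.pi * (2 * (j : ℝ) - 3) / k), -Real.cos (Real.pi * (2 * (j : ℝ) - 3) / k)]

/-- The conditional set: all vertices `A_1, …, A_k`. -/
def vertices (k : ℕ) : Set Plane := vertex k '' Set.Icc 1 k

/-- Arc length measure on the boundary `L` of the regular `k`-gon. The side from `A_j` to `A_(j+1)`
is parametrized by `t ↦ (1 - t) A_j + t A_(j+1)` with `0 ≤ t ≤ 1`, so that on it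
`ds = dist A_j A_(j+1) dt`. -/
def arcLength (k : ℕ) : Measure Plane :=
  ∑ j ∈ Finset.Icc 1 k, ENNReal.ofReal (dist (vertex k j) (vertex k (j + 1))) •
    (volume.restrict (Set.Icc (0 : ℝ) 1)).map
      (fun t : ℝ => (1 - t) • vertex k j + t • vertex k (j + 1))

/-- The measure with constant density `1 / k` with respect to arc length on the boundary. -/
def polygonMeasure (k : ℕ) : Measure Plane := (k : ENNReal)⁻¹ • arcLength k

/-- The uniform probability distribution on the boundary: arc length divided by the perimeter. -/
def uniformProb (k : ℕ) : Measure Plane := (arcLength k Set.univ)⁻¹ • arcLength k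

end CondQuantization

end

/-!
Let `l = 2 sin (π / k)` be the side length and `c` the density with respect to arc length. All
claims follow from `n ^ 2 * V n → c * (k * l) ^ 3 / 12` (`tendsto_sq_mul_condError`), which forces
`V n → 0`, together with strict monotonicity of `V` (`strictAntiOn_condError`).

*Lower bound.* For a finite set `S` and every `h ≥ 0`,
`min_{a ∈ S} d(x, a)² ≥ h² - ∑_{a ∈ S} max (h² - d(x, a)²) 0`. After projection to a line, the
integral of one summand along a segment is at most `∫ max (h² - s²) 0 ds = 4 / 3 * h ^ 3`. Cut off
from each side the part with parameter within `δ` of an endpoint. The remaining pieces, of total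
length `T = k * l * (1 - 2 * δ)`, are uniformly separated (`side_eq_of_dist_lt`), so for small `h`
no point of the plane, wherever it lies, serves two of them, and `n` points have error at least
`T * h² - n * (4 / 3 * h ^ 3)` (`le_sum_integral_infDist_sq`). With `h = T / (2 * n)`, which is
small for large `n`, this is `T ^ 3 / (12 * n ^ 2)`; finally `δ → 0`. No information on the shape
of optimal sets is needed.

*Upper bound.* Divide every side into `⌊n / k⌋` equal parts (`condError_le_of_mul_le`).

*Strict decrease.* The lower bound on a single side, where no separation is needed, shows that any
`n` points leave some point of that side at distance at least `l / (4 * n)`. Adding this point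
reduces the error by an amount depending on `n` only (`exists_insert_integral_le`), and this
survives taking the infimum, so that minimizers need not exist.
-/

open MeasureTheory Filter Topology

namespace CondQuantization

/-! ### Lower bounds from sums of parabolic bumps -/

/-- The parabolic bump of radius `h`. -/
def bump (h s : ℝ) : ℝ := max (h ^ 2 - s ^ 2) 0

lemma bump_nonneg (h s : ℝ) : 0 ≤ bump h s := le_max_right _ _

lemma continuous_bump (h : ℝ) : Continuous (bump h) := by
  unfold bump; fun_prop

lemma bump_eq_indicator {h : ℝ} (hh : 0 ≤ h) :
    bump h = (Set.Icc (-h) h).indicator (fun s => h ^ 2 - s ^ 2) := by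
  funext s
  unfold bump
  by_cases hs : s ∈ Set.Icc (-h) h
  · rw [Set.indicator_of_mem hs]
    exact max_eq_left (by nlinarith [hs.1, hs.2])
  · rw [Set.indicator_of_notMem hs]
    apply max_eq_right
    by_contra! hlt
    exact hs (abs_le.1 (abs_le_of_sq_le_sq (by linarith) hh))

lemma bump_eq_zero {h s : ℝ} (hh : 0 ≤ h) (hs : h ≤ |s|) : bump h s = 0 := by
  unfold bump
  exact max_eq_right (by nlinarith [sq_abs s])

lemma bump_antitone {h s s' : ℝ} (hs : |s'| ≤ |s|) : bump h s ≤ bump h s' := by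
  unfold bump
  exact max_le_max (by nlinarith [sq_abs s, sq_abs s', abs_nonneg s']) le_rfl

lemma integrable_bump {h : ℝ} (hh : 0 ≤ h) : Integrable (bump h) := by
  rw [bump_eq_indicator hh]
  refine (ContinuousOn.integrableOn_compact isCompact_Icc ?_).integrable_indicator measurableSet_Icc
  fun_prop

lemma integral_bump {h : ℝ} (hh : 0 ≤ h) : ∫ s, bump h s = 4 / 3 * h ^ 3 := by
  rw [bump_eq_indicator hh, integral_indicator measurableSet_Icc, integral_Icc_eq_integral_Ioc,
    ← intervalIntegral.integral_of_le (by linarith),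
    intervalIntegral.integral_sub (by simp) (by apply Continuous.intervalIntegrable; fun_prop)]
  simp
  ring

/-- The point with parameter `t` on the segment from `p` to `q`. -/
def seg (p q : Plane) (t : ℝ) : Plane := (1 - t) • p + t • q

lemma continuous_seg (p q : Plane) : Continuous (seg p q) := by
  unfold seg; fun_prop

lemma dist_seg_seg (p q : Plane) (s t : ℝ) :
    dist (seg p q s) (seg p q t) = dist p q * |s - t| := by
  have : seg p q s - seg p q t = (t - s) • (p - q) := by unfold seg; module
  rw [dist_eq_norm, this, norm_smul, dist_eq_norm, Real.norm_eq_abs, abs_sub_comm, mul_comm]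

lemma continuous_infDist_seg (p q : Plane) (γ : Set Plane) :
    Continuous (fun t => Metric.infDist (seg p q t) γ ^ 2) :=
  ((Metric.continuous_infDist_pt γ).comp (continuous_seg p q)).pow 2

/-- Orthogonal projection of `x` to the line through `p` and `q` brings it closer to the
points of that line. -/
lemma exists_abs_le_dist_seg {p q : Plane} (hpq : p ≠ q) (x : Plane) :
    ∃ b : ℝ, ∀ t, |dist p q * t - b| ≤ dist (seg p q t) x := by
  have hl : 0 < ‖q - p‖ := norm_pos_iff.2 (sub_ne_zero.2 hpq.symm)
  refine ⟨inner ℝ (q - p) (x - p) / ‖q - p‖, fun t => ?_⟩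
  have h1 : inner ℝ (q - p) (seg p q t - x) = t * ‖q - p‖ ^ 2 - inner ℝ (q - p) (x - p) := by
    have : seg p q t - x = t • (q - p) - (x - p) := by unfold seg; module
    rw [this, inner_sub_right, inner_smul_right, real_inner_self_eq_norm_sq]
  have h2 := abs_real_inner_le_norm (q - p) (seg p q t - x)
  have h3 : dist p q * t - inner ℝ (q - p) (x - p) / ‖q - p‖
      = inner ℝ (q - p) (seg p q t - x) / ‖q - p‖ := by
    rw [h1, dist_comm, dist_eq_norm]; field_simp
  rw [h3, abs_div, abs_of_pos hl, div_le_iff₀ hl, dist_eq_norm]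
  linarith

lemma integral_bump_seg_le {p q : Plane} (hpq : p ≠ q) (x : Plane) {h : ℝ} (hh : 0 ≤ h)
    (a b : ℝ) :
    dist p q * ∫ t in Set.Icc a b, bump h (dist (seg p q t) x) ≤ 4 / 3 * h ^ 3 := by
  obtain ⟨c, hc⟩ := exists_abs_le_dist_seg hpq x
  have hl : 0 < dist p q := dist_pos.2 hpq
  have hint : Integrable (fun t => bump h (dist p q * t - c)) :=
    ((integrable_bump hh).comp_sub_right c).comp_mul_left' hl.ne'
  have h1 : ∫ t, bump h (dist p q * t - c) = (dist p q)⁻¹ * (4 / 3 * h ^ 3) := by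
    rw [Measure.integral_comp_mul_left (fun s => bump h (s - c)) (dist p q),
      integral_sub_right_eq_self (bump h) c, integral_bump hh, abs_of_pos (inv_pos.2 hl)]
    rfl
  have h2 : ∫ t in Set.Icc a b, bump h (dist (seg p q t) x)
      ≤ ∫ t in Set.Icc a b, bump h (dist p q * t - c) := by
    refine setIntegral_mono ?_ hint.integrableOn fun t => bump_antitone ?_
    · refine ContinuousOn.integrableOn_compact isCompact_Icc (Continuous.continuousOn ?_)
      exact (continuous_bump h).comp ((continuous_seg p q).dist continuous_const)
    · rw [abs_of_nonneg dist_nonneg]; exact hc t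
  have h3 : ∫ t in Set.Icc a b, bump h (dist p q * t - c) ≤ ∫ t, bump h (dist p q * t - c) :=
    setIntegral_le_integral hint (Eventually.of_forall fun t => bump_nonneg _ _)
  calc _ ≤ dist p q * ((dist p q)⁻¹ * (4 / 3 * h ^ 3)) := by
        gcongr; linarith
    _ = _ := by field_simp

lemma sub_sum_bump_le_infDist_sq (S : Finset Plane) (hS : S.Nonempty) (h : ℝ) (x : Plane) :
    h ^ 2 - ∑ a ∈ S, bump h (dist x a) ≤ Metric.infDist x S ^ 2 := by
  obtain ⟨a, ha, hxa⟩ := S.finite_toSet.isCompact.exists_infDist_eq_dist (by simpa using hS) x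
  have h1 : bump h (dist x a) ≤ ∑ a ∈ S, bump h (dist x a) :=
    Finset.single_le_sum (f := fun a => bump h (dist x a)) (fun i _ => bump_nonneg _ _)
      (by simpa using ha)
  have h2 : h ^ 2 - dist x a ^ 2 ≤ bump h (dist x a) := le_max_left _ _
  rw [hxa]; linarith

/-- A lower bound for the quantization error on finitely many pieces of segments of equal length, no two of which are
both within distance `h` of the same point: every point of `S` can then lower the integral of the
constant `h ^ 2` over the pieces by at most the integral of one bump. -/
lemma le_sum_integral_infDist_sq {ι : Type*} (J : Finset ι) (p q : ι → Plane) {l : ℝ}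
    (hl : 0 < l) (hpq : ∀ j ∈ J, dist (p j) (q j) = l) {a b h : ℝ} (hab : a ≤ b) (hh : 0 ≤ h)
    (hsep : ∀ x, ∀ i ∈ J, ∀ j ∈ J, ∀ s ∈ Set.Icc a b, ∀ t ∈ Set.Icc a b,
      dist (seg (p i) (q i) s) x < h → dist (seg (p j) (q j) t) x < h → i = j)
    (S : Finset Plane) (hS : S.Nonempty) :
    J.card * (l * (b - a)) * h ^ 2 - S.card * (4 / 3 * h ^ 3) ≤
      l * ∑ j ∈ J, ∫ t in Set.Icc a b, Metric.infDist (seg (p j) (q j) t) S ^ 2 := by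
  have hb (j : ι) (x : Plane) : IntegrableOn (fun t => bump h (dist (seg (p j) (q j) t) x))
      (Set.Icc a b) :=
    ContinuousOn.integrableOn_compact isCompact_Icc (Continuous.continuousOn
      ((continuous_bump h).comp ((continuous_seg _ _).dist continuous_const)))
  have key (x : Plane) :
      l * ∑ j ∈ J, ∫ t in Set.Icc a b, bump h (dist (seg (p j) (q j) t) x) ≤ 4 / 3 * h ^ 3 := by
    by_cases hx : ∃ j ∈ J, ∃ t ∈ Set.Icc a b, dist (seg (p j) (q j) t) x < h
    · obtain ⟨j, hj, t, ht, hd⟩ := hx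
      rw [Finset.sum_eq_single_of_mem j hj]
      · have := integral_bump_seg_le (p := p j) (q := q j)
          (dist_pos.1 (by rw [hpq j hj]; exact hl)) x hh a b
        rwa [hpq j hj] at this
      · intro i hi hij
        refine (setIntegral_congr_fun measurableSet_Icc fun s hs => ?_).trans (integral_zero _ _)
        refine bump_eq_zero hh ?_
        rw [abs_of_nonneg dist_nonneg]
        by_contra! hlt
        exact hij (hsep x i hi j hj s hs t ht hlt hd)
    · push Not at hx
      rw [Finset.sum_eq_zero]
      · simp only [mul_zero]; positivity
      · intro i hi
        refine (setIntegral_congr_fun measurableSet_Icc fun s hs => ?_).trans (integral_zero _ _)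
        refine bump_eq_zero hh ?_
        rw [abs_of_nonneg dist_nonneg]
        exact hx i hi s hs
  have h1 : ∀ j ∈ J, (b - a) * h ^ 2
        - ∑ x ∈ S, ∫ t in Set.Icc a b, bump h (dist (seg (p j) (q j) t) x)
      ≤ ∫ t in Set.Icc a b, Metric.infDist (seg (p j) (q j) t) S ^ 2 := by
    intro j _
    rw [← integral_finsetSum _ fun x _ => hb j x]
    have hc : ∫ _ in Set.Icc a b, h ^ 2 = (b - a) * h ^ 2 := by
      simp [hab]
    rw [← hc, ← integral_sub (by simp) (integrable_finsetSum _ fun x _ => hb j x)]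
    refine setIntegral_mono ?_ ?_ fun t => sub_sum_bump_le_infDist_sq S hS h _
    · exact Integrable.sub (by simp) (integrable_finsetSum _ fun x _ => hb j x)
    · exact (continuous_infDist_seg _ _ _).continuousOn.integrableOn_compact isCompact_Icc
  have h2 := Finset.sum_le_sum h1
  rw [Finset.sum_sub_distrib, Finset.sum_comm, Finset.sum_const, nsmul_eq_mul] at h2
  have h3 : ∑ x ∈ S, l * ∑ j ∈ J, ∫ t in Set.Icc a b, bump h (dist (seg (p j) (q j) t) x)
      ≤ S.card * (4 / 3 * h ^ 3) := by
    have := Finset.sum_le_sum fun x (_ : x ∈ S) => key x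
    rwa [Finset.sum_const, nsmul_eq_mul] at this
  rw [← Finset.mul_sum] at h3
  have h4 := mul_le_mul_of_nonneg_left h2 hl.le
  rw [mul_sub] at h4
  linarith

/-! ### Upper bound from equally spaced points -/

lemma integral_le_of_le_sq_grid {f : ℝ → ℝ} (hf : Continuous f) {m : ℕ} (hm : 0 < m) {l : ℝ}
    (hle : ∀ t, ∀ i ≤ m, f t ≤ (l * (t - i / m)) ^ 2) :
    ∫ t in Set.Icc (0 : ℝ) 1, f t ≤ l ^ 2 / (12 * m ^ 2) := by
  have hm' : (0 : ℝ) < m := by exact_mod_cast hm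
  have hi (a b : ℝ) : IntervalIntegrable f volume a b := hf.intervalIntegrable a b
  have hcell : ∀ i < m, ∫ t in ((i : ℕ) / m : ℝ)..((i + 1 : ℕ) / m : ℝ), f t
      ≤ l ^ 2 / (12 * m ^ 3) := by
    intro i him
    have hpar (c u v : ℝ) : ∫ t in u..v, (l * (t - c)) ^ 2
        = l ^ 2 * (((v - c) ^ 3 - (u - c) ^ 3) / 3) := by
      simp_rw [mul_pow]
      rw [intervalIntegral.integral_const_mul,
        intervalIntegral.integral_comp_sub_right (fun x => x ^ 2) c, integral_pow]
      norm_num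
    rw [← intervalIntegral.integral_add_adjacent_intervals (hi _ ((i + 1 / 2) / m : ℝ)) (hi _ _)]
    have e1 : ∫ t in ((i : ℕ) / m : ℝ)..((i + 1 / 2) / m : ℝ), f t
        ≤ ∫ t in ((i : ℕ) / m : ℝ)..((i + 1 / 2) / m : ℝ), (l * (t - (i : ℕ) / m)) ^ 2 :=
      intervalIntegral.integral_mono_on (by gcongr; linarith) (hi _ _)
        (Continuous.intervalIntegrable (by fun_prop) _ _) fun t _ => hle t i him.le
    have e2 : ∫ t in ((i + 1 / 2) / m : ℝ)..((i + 1 : ℕ) / m : ℝ), f t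
        ≤ ∫ t in ((i + 1 / 2) / m : ℝ)..((i + 1 : ℕ) / m : ℝ),
          (l * (t - (i + 1 : ℕ) / m)) ^ 2 :=
      intervalIntegral.integral_mono_on (by push_cast; gcongr; norm_num) (hi _ _)
        (Continuous.intervalIntegrable (by fun_prop) _ _) fun t _ => hle t (i + 1) him
    rw [hpar] at e1 e2
    refine (add_le_add e1 e2).trans (le_of_eq ?_)
    push_cast
    field_simp
    ring
  rw [integral_Icc_eq_integral_Ioc, ← intervalIntegral.integral_of_le zero_le_one]
  have hsum := intervalIntegral.sum_integral_adjacent_intervals (μ := volume) (f := f)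
    (a := fun i : ℕ => (i / m : ℝ)) (n := m) fun i _ => hi _ _
  simp only [Nat.cast_zero, zero_div, div_self hm'.ne'] at hsum
  rw [← hsum]
  calc _ ≤ ∑ i ∈ Finset.range m, l ^ 2 / (12 * (m : ℝ) ^ 3) :=
        Finset.sum_le_sum fun i him => hcell i (Finset.mem_range.1 him)
    _ = _ := by rw [Finset.sum_const, Finset.card_range, nsmul_eq_mul]; field_simp

/-! ### Geometry of the regular polygon -/

lemma dist_vertex_succ {k : ℕ} (hk : 3 ≤ k) (j : ℕ) :
    dist (vertex k j) (vertex k (j + 1)) = 2 * Real.sin (Real.pi / k) := by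
  have hk0 : (k : ℝ) ≠ 0 := by positivity
  have hs : 0 ≤ Real.sin (Real.pi / k) := by
    apply Real.sin_nonneg_of_nonneg_of_le_pi (by positivity)
    exact div_le_self Real.pi_pos.le (by exact_mod_cast (by omega : 1 ≤ k))
  have hang : Real.pi * (2 * ((j + 1 : ℕ) : ℝ) - 3) / k
      = Real.pi * (2 * (j : ℝ) - 3) / k + 2 * (Real.pi / k) := by
    push_cast; field_simp; ring
  rw [EuclideanSpace.dist_eq, Fin.sum_univ_two]
  simp only [vertex, hang, Real.dist_eq, sq_abs]
  simp only [Matrix.cons_val_zero, Matrix.cons_val_one]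
  rw [Real.sqrt_eq_iff_mul_self_eq (by positivity) (by positivity)]
  generalize Real.pi * (2 * (j : ℝ) - 3) / k = u
  generalize Real.pi / k = v
  rw [Real.sin_add, Real.cos_add, Real.sin_two_mul, Real.cos_two_mul]
  have h1 := Real.sin_sq_add_cos_sq u
  have h2 := Real.sin_sq_add_cos_sq v
  have e1 : Real.sin u ^ 2 = 1 - Real.cos u ^ 2 := by linarith
  have e2 : Real.sin v ^ 2 = 1 - Real.cos v ^ 2 := by linarith
  ring_nf
  simp only [e1, e2]
  ring_nf

lemma sin_pi_div_pos {k : ℕ} (hk : 3 ≤ k) : 0 < Real.sin (Real.pi / k) := by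
  have hk' : (3 : ℝ) ≤ k := by exact_mod_cast hk
  apply Real.sin_pos_of_pos_of_lt_pi (by positivity)
  exact div_lt_self Real.pi_pos (by linarith)

lemma vertex_add_one_self {k : ℕ} (hk : 3 ≤ k) : vertex k (k + 1) = vertex k 1 := by
  have hk0 : (k : ℝ) ≠ 0 := by positivity
  have hang : Real.pi * (2 * ((k + 1 : ℕ) : ℝ) - 3) / k
      = Real.pi * (2 * ((1 : ℕ) : ℝ) - 3) / k + 2 * Real.pi := by
    push_cast; field_simp; ring
  simp only [vertex, hang, Real.sin_add_two_pi, Real.cos_add_two_pi]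

lemma vertex_succ_mem_vertices {k : ℕ} (hk : 3 ≤ k) {j : ℕ} (hj : j ∈ Finset.Icc 1 k) :
    vertex k (j + 1) ∈ vertices k := by
  rw [Finset.mem_Icc] at hj
  rcases hj.2.eq_or_lt with rfl | h
  · rw [vertex_add_one_self hk]
    exact ⟨1, ⟨le_rfl, by omega⟩, rfl⟩
  · exact ⟨j + 1, ⟨by omega, by omega⟩, rfl⟩

lemma cos_le_cos_of_le_abs {r y : ℝ} (hr0 : 0 ≤ r) (hr : r ≤ |y|) (hy : |y| ≤ 2 * Real.pi - r) :
    Real.cos y ≤ Real.cos r := by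
  rw [← Real.cos_abs y]
  rcases le_total |y| Real.pi with h | h
  · exact Real.cos_le_cos_of_nonneg_of_le_pi hr0 h hr
  · rw [← Real.cos_two_pi_sub |y|]
    exact Real.cos_le_cos_of_nonneg_of_le_pi hr0 (by linarith) (by linarith)

/-- The component of `x` along the outer unit normal of the `j`th side of the regular `k`-gon. -/
noncomputable def normalCoord (k j : ℕ) (x : Plane) : ℝ :=
  Real.sin (Real.pi * (2 * (j : ℝ) - 2) / k) * x 0 -
    Real.cos (Real.pi * (2 * (j : ℝ) - 2) / k) * x 1

lemma normalCoord_sub_le_dist (k j : ℕ) (x y : Plane) :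
    normalCoord k j x - normalCoord k j y ≤ dist x y := by
  rw [EuclideanSpace.dist_eq, Fin.sum_univ_two]
  apply Real.le_sqrt_of_sq_le
  simp only [normalCoord, Real.dist_eq, sq_abs]
  generalize Real.pi * (2 * (j : ℝ) - 2) / k = u
  have h1 := Real.sin_sq_add_cos_sq u
  have h2 := sq_nonneg (Real.cos u * (x 0 - y 0) + Real.sin u * (x 1 - y 1))
  have h3 : (Real.sin u * x 0 - Real.cos u * x 1 - (Real.sin u * y 0 - Real.cos u * y 1)) ^ 2
      + (Real.cos u * (x 0 - y 0) + Real.sin u * (x 1 - y 1)) ^ 2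
      = (Real.sin u ^ 2 + Real.cos u ^ 2) * ((x 0 - y 0) ^ 2 + (x 1 - y 1) ^ 2) := by ring
  rw [h1] at h3
  linarith

lemma normalCoord_seg (k j : ℕ) (p q : Plane) (t : ℝ) :
    normalCoord k j (seg p q t) = (1 - t) * normalCoord k j p + t * normalCoord k j q := by
  simp only [normalCoord, seg, PiLp.add_apply, PiLp.smul_apply, smul_eq_mul]
  ring

lemma normalCoord_vertex {k : ℕ} (i j : ℕ) :
    normalCoord k j (vertex k i) = Real.cos (((2 * ((i : ℤ) - j) - 1 : ℤ) : ℝ) * (Real.pi / k)) := by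
  have : ((2 * ((i : ℤ) - j) - 1 : ℤ) : ℝ) * (Real.pi / k)
      = Real.pi * (2 * (i : ℝ) - 3) / k - Real.pi * (2 * (j : ℝ) - 2) / k := by
    push_cast; ring
  rw [this, Real.cos_sub]
  simp only [normalCoord, vertex, PiLp.toLp_apply, Matrix.cons_val_zero, Matrix.cons_val_one]
  ring

lemma cos_int_mul_pi_div_le {k : ℕ} (hk : 3 ≤ k) {r m : ℤ} (hr : 0 ≤ r) (h1 : r ≤ |m|)
    (h2 : |m| ≤ 2 * k - r) :
    Real.cos (m * (Real.pi / k)) ≤ Real.cos (r * (Real.pi / k)) := by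
  have hk' : (0 : ℝ) < k := by positivity
  have hp : 0 < Real.pi / k := by positivity
  have habs : |(m : ℝ) * (Real.pi / k)| = ((|m| : ℤ) : ℝ) * (Real.pi / k) := by
    rw [abs_mul, abs_of_pos hp, Int.cast_abs]
  have h1' : (r : ℝ) ≤ ((|m| : ℤ) : ℝ) := by exact_mod_cast h1
  have h2' : ((|m| : ℤ) : ℝ) ≤ 2 * k - r := by exact_mod_cast h2
  have hr' : (0 : ℝ) ≤ r := by exact_mod_cast hr
  apply cos_le_cos_of_le_abs (by positivity)
  · rw [habs]; gcongr
  · rw [habs]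
    calc _ ≤ (2 * k - r) * (Real.pi / k) := by gcongr
      _ = _ := by field_simp

/-- The gap between the largest and the second largest normal coordinate of a vertex. -/
noncomputable def normalGap (k : ℕ) : ℝ := Real.cos (Real.pi / k) - Real.cos (3 * (Real.pi / k))

lemma normalGap_pos {k : ℕ} (hk : 3 ≤ k) : 0 < normalGap k := by
  have hk' : (3 : ℝ) ≤ k := by exact_mod_cast hk
  have hp : 0 < Real.pi / k := by positivity
  refine sub_pos.2 (Real.cos_lt_cos_of_nonneg_of_le_pi hp.le ?_ (by linarith))
  rw [mul_div_assoc', div_le_iff₀ (by linarith)]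
  nlinarith [Real.pi_pos]

lemma normalCoord_side_self (k j : ℕ) (t : ℝ) :
    normalCoord k j (seg (vertex k j) (vertex k (j + 1)) t) = Real.cos (Real.pi / k) := by
  rw [normalCoord_seg, normalCoord_vertex, normalCoord_vertex]
  have e1 : (2 * ((j : ℤ) - j) - 1 : ℤ) = -1 := by ring
  have e2 : (2 * (((j + 1 : ℕ) : ℤ) - j) - 1 : ℤ) = 1 := by push_cast; ring
  rw [e1, e2]
  push_cast
  rw [neg_one_mul, Real.cos_neg, one_mul]
  ring

/-- One of the two endpoints of a side different from the `j`th one is not on the `j`th side. -/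
lemma normalCoord_side_le {k : ℕ} (hk : 3 ≤ k) {i j : ℕ} (hi : i ∈ Finset.Icc 1 k)
    (hj : j ∈ Finset.Icc 1 k) (hij : i ≠ j) {δ t : ℝ} (hδ : 0 ≤ δ) (ht : t ∈ Set.Icc δ (1 - δ)) :
    normalCoord k j (seg (vertex k i) (vertex k (i + 1)) t) ≤
      Real.cos (Real.pi / k) - δ * normalGap k := by
  rw [Finset.mem_Icc] at hi hj
  obtain ⟨ht0, ht1⟩ := ht
  have hgap := normalGap_pos hk
  have hg : normalGap k = Real.cos (Real.pi / k) - Real.cos (3 * (Real.pi / k)) := rfl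
  rw [normalCoord_seg, normalCoord_vertex, normalCoord_vertex]
  have b1 {m : ℤ} (h1 : 1 ≤ |m|) (h2 : |m| ≤ 2 * k - 1) :
      Real.cos (m * (Real.pi / k)) ≤ Real.cos (Real.pi / k) := by
    simpa using cos_int_mul_pi_div_le hk (r := 1) (by norm_num) h1 h2
  have b3 {m : ℤ} (h1 : 3 ≤ |m|) (h2 : |m| ≤ 2 * k - 3) :
      Real.cos (m * (Real.pi / k)) ≤ Real.cos (3 * (Real.pi / k)) := by
    simpa using cos_int_mul_pi_div_le hk (r := 3) (by norm_num) h1 h2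
  have c1 := @b1 (2 * ((i : ℤ) - j) - 1) (by rw [le_abs]; omega)
    (abs_le.2 ⟨by omega, by omega⟩)
  have c2 := @b1 (2 * (((i + 1 : ℕ) : ℤ) - j) - 1) (by rw [le_abs]; omega)
    (abs_le.2 ⟨by omega, by omega⟩)
  have hor : (3 ≤ |2 * ((i : ℤ) - j) - 1| ∧ |2 * ((i : ℤ) - j) - 1| ≤ 2 * k - 3) ∨
      (3 ≤ |2 * (((i + 1 : ℕ) : ℤ) - j) - 1| ∧ |2 * (((i + 1 : ℕ) : ℤ) - j) - 1| ≤ 2 * k - 3) := by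
    simp only [le_abs, abs_le]
    omega
  rcases hor with ⟨h1, h2⟩ | ⟨h1, h2⟩
  · have := b3 h1 h2
    nlinarith
  · have := b3 h1 h2
    nlinarith

/-- Away from the vertices, the sides of the polygon are uniformly separated. -/
lemma side_eq_of_dist_lt {k : ℕ} (hk : 3 ≤ k) {i j : ℕ} (hi : i ∈ Finset.Icc 1 k)
    (hj : j ∈ Finset.Icc 1 k) {δ h s t : ℝ} (hδ : 0 ≤ δ) (hh : 2 * h ≤ δ * normalGap k)
    (hs : s ∈ Set.Icc δ (1 - δ)) {x : Plane}
    (hx : dist (seg (vertex k i) (vertex k (i + 1)) s) x < h)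
    (hy : dist (seg (vertex k j) (vertex k (j + 1)) t) x < h) : i = j := by
  by_contra hij
  have h1 := normalCoord_side_le hk hi hj hij hδ hs
  have h2 := normalCoord_side_self k j t
  have h3 := normalCoord_sub_le_dist k j (seg (vertex k j) (vertex k (j + 1)) t)
    (seg (vertex k i) (vertex k (i + 1)) s)
  have h4 := dist_triangle_right (seg (vertex k j) (vertex k (j + 1)) t)
    (seg (vertex k i) (vertex k (i + 1)) s) x
  linarith

/-! ### The distortion error in terms of the sides -/

/-- The sum over the sides of the integrals of the squared distance to `γ`, each side being
parametrized by `[0, 1]`. -/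
noncomputable def sideError (k : ℕ) (γ : Set Plane) : ℝ :=
  ∑ j ∈ Finset.Icc 1 k, ∫ t in Set.Icc (0 : ℝ) 1,
    Metric.infDist (seg (vertex k j) (vertex k (j + 1)) t) γ ^ 2

lemma distortion_smul_arcLength {k : ℕ} (hk : 3 ≤ k) (c : ENNReal) (γ : Set Plane) :
    distortion (c • arcLength k) γ =
      c.toReal * (2 * Real.sin (Real.pi / k) * sideError k γ) := by
  have hs := (sin_pi_div_pos hk).le
  have hc : Continuous fun x : Plane => Metric.infDist x γ ^ 2 :=
    (Metric.continuous_infDist_pt γ).pow 2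
  have hm (j : ℕ) : Measurable (seg (vertex k j) (vertex k (j + 1))) :=
    (continuous_seg _ _).measurable
  have hint (j : ℕ) : Integrable (fun x : Plane => Metric.infDist x γ ^ 2)
      ((volume.restrict (Set.Icc (0 : ℝ) 1)).map (seg (vertex k j) (vertex k (j + 1)))) := by
    rw [integrable_map_measure hc.aestronglyMeasurable (hm j).aemeasurable]
    exact (continuous_infDist_seg _ _ _).continuousOn.integrableOn_compact isCompact_Icc
  have harc : arcLength k = ∑ j ∈ Finset.Icc 1 k,
      ENNReal.ofReal (2 * Real.sin (Real.pi / k)) •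
        (volume.restrict (Set.Icc (0 : ℝ) 1)).map (seg (vertex k j) (vertex k (j + 1))) := by
    unfold arcLength
    simp_rw [dist_vertex_succ hk]
    rfl
  unfold distortion sideError
  rw [integral_smul_measure, harc, integral_finsetSum_measure, Finset.mul_sum, smul_eq_mul]
  · congr 1
    refine Finset.sum_congr rfl fun j _ => ?_
    rw [integral_smul_measure, ENNReal.toReal_ofReal (by positivity),
      integral_map (hm j).aemeasurable hc.aestronglyMeasurable, smul_eq_mul]
  · exact fun j _ => (hint j).smul_measure ENNReal.ofReal_ne_top

lemma arcLength_univ {k : ℕ} (hk : 3 ≤ k) :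
    arcLength k Set.univ = ENNReal.ofReal (k * (2 * Real.sin (Real.pi / k))) := by
  have hm (j : ℕ) : Measurable fun t : ℝ => (1 - t) • vertex k j + t • vertex k (j + 1) :=
    (continuous_seg _ _).measurable
  unfold arcLength
  simp_rw [dist_vertex_succ hk]
  rw [Measure.finsetSum_apply, ENNReal.ofReal_mul (by positivity)]
  simp [Measure.map_apply (hm _) MeasurableSet.univ]

lemma setIntegral_infDist_sq_mono (p q : Plane) {γ γ' : Set Plane} (hγ : γ.Nonempty)
    (h : γ ⊆ γ') (a b : ℝ) :
    ∫ t in Set.Icc a b, Metric.infDist (seg p q t) γ' ^ 2 ≤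
      ∫ t in Set.Icc a b, Metric.infDist (seg p q t) γ ^ 2 := by
  refine setIntegral_mono ?_ ?_ fun t => ?_
  · exact (continuous_infDist_seg _ _ _).continuousOn.integrableOn_compact isCompact_Icc
  · exact (continuous_infDist_seg _ _ _).continuousOn.integrableOn_compact isCompact_Icc
  · exact pow_le_pow_left₀ Metric.infDist_nonneg (Metric.infDist_le_infDist_of_subset h hγ) 2

/-! ### Strict decrease of the conditional errors -/

/-- Some point of a segment is far from any given set of at most `n` points. -/
lemma exists_le_infDist_seg {p q : Plane} (hpq : p ≠ q) {n : ℕ} (hn : 0 < n) (S : Finset Plane)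
    (hS : S.Nonempty) (hcard : S.card ≤ n) :
    ∃ t ∈ Set.Icc (0 : ℝ) 1, dist p q / (4 * n) ≤ Metric.infDist (seg p q t) S := by
  have hl : 0 < dist p q := dist_pos.2 hpq
  have hn' : (0 : ℝ) < n := by exact_mod_cast hn
  have hcard' : (S.card : ℝ) ≤ n := by exact_mod_cast hcard
  by_contra! hlt
  -- `h = dist p q / (2 * n)` makes the lower bound for the error largest
  have h1 := le_sum_integral_infDist_sq (ι := Unit) {()} (fun _ => p) (fun _ => q) hl
    (fun _ _ => rfl) zero_le_one (h := dist p q / (2 * n)) (by positivity)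
    (fun _ _ _ _ _ _ _ _ _ _ _ => rfl) S hS
  have h2 : ∫ t in Set.Icc (0 : ℝ) 1, Metric.infDist (seg p q t) S ^ 2
      ≤ (dist p q / (4 * n)) ^ 2 := by
    have : ∫ _ in Set.Icc (0 : ℝ) 1, (dist p q / (4 * n)) ^ 2 = (dist p q / (4 * n)) ^ 2 := by
      simp
    rw [← this]
    refine setIntegral_mono_on ?_ (by simp) measurableSet_Icc fun t ht =>
      pow_le_pow_left₀ Metric.infDist_nonneg (hlt t ht).le 2
    exact (continuous_infDist_seg _ _ _).continuousOn.integrableOn_compact isCompact_Icc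
  simp only [Finset.card_singleton, Nat.cast_one, one_mul, sub_zero, mul_one,
    Finset.sum_singleton] at h1
  have h3 : dist p q * (dist p q / (2 * n)) ^ 2 - n * (4 / 3 * (dist p q / (2 * n)) ^ 3)
      ≤ dist p q * (dist p q / (4 * n)) ^ 2 := by
    refine le_trans (le_trans ?_ h1) (by gcongr)
    gcongr
  have h4 : dist p q * (dist p q / (2 * n)) ^ 2 - n * (4 / 3 * (dist p q / (2 * n)) ^ 3)
      = dist p q * (dist p q / (4 * n)) ^ 2 + dist p q ^ 3 / (48 * n ^ 2) := by
    field_simp; ring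
  have : 0 < dist p q ^ 3 / (48 * (n : ℝ) ^ 2) := by positivity
  linarith

/-- Adding a suitable point to a set of at most `n` points reduces the error on a segment by an
amount that depends only on `n` and on the length of the segment. -/
lemma exists_insert_integral_le {p q : Plane} (hpq : p ≠ q) {n : ℕ} (hn : 0 < n)
    (S : Finset Plane) (hS : S.Nonempty) (hcard : S.card ≤ n) :
    ∃ x, (∫ t in Set.Icc (0 : ℝ) 1, Metric.infDist (seg p q t) (insert x (S : Set Plane)) ^ 2)
        + 1 / (16 * n) * ((dist p q / (4 * n)) ^ 2 / 2)
      ≤ ∫ t in Set.Icc (0 : ℝ) 1, Metric.infDist (seg p q t) S ^ 2 := by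
  have hl : 0 < dist p q := dist_pos.2 hpq
  have hn' : (1 : ℝ) ≤ n := by exact_mod_cast hn
  obtain ⟨t₀, ⟨ht0, ht1⟩, hr⟩ := exists_le_infDist_seg hpq hn S hS hcard
  set r := dist p q / (4 * n) with hrdef
  set s : ℝ := 1 / (16 * n) with hsdef
  have hrpos : 0 < r := by positivity
  have hspos : 0 < s := by positivity
  have hs1 : s ≤ 1 := by
    rw [hsdef, div_le_one (by positivity)]; linarith
  have hls : dist p q * s = r / 4 := by rw [hrdef, hsdef]; field_simp; norm_num
  set x := seg p q t₀ with hx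
  refine ⟨x, ?_⟩
  have hint (γ : Set Plane) (a b : ℝ) :
      IntegrableOn (fun t => Metric.infDist (seg p q t) γ ^ 2) (Set.Icc a b) :=
    (continuous_infDist_seg _ _ _).continuousOn.integrableOn_compact isCompact_Icc
  -- an interval of length `s` inside `[0, 1]` that contains `t₀`
  set c := min t₀ (1 - s) with hc
  have hc0 : 0 ≤ c := le_min ht0 (by linarith)
  have hc1 : c + s ≤ 1 := by linarith [min_le_right t₀ (1 - s)]
  have hct : c ≤ t₀ := min_le_left _ _
  have htc : t₀ ≤ c + s := by
    rcases min_choice t₀ (1 - s) with h | h <;> rw [hc, h] <;> linarith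
  have hgain : ∀ t ∈ Set.Icc c (c + s), r ^ 2 / 2 ≤ Metric.infDist (seg p q t) S ^ 2
      - Metric.infDist (seg p q t) (insert x (S : Set Plane)) ^ 2 := by
    rintro t ⟨h1, h2⟩
    have hd : dist (seg p q t) x ≤ r / 4 := by
      rw [hx, dist_seg_seg, ← hls]
      gcongr
      exact abs_le.2 ⟨by linarith, by linarith⟩
    have u1 : Metric.infDist (seg p q t) (insert x (S : Set Plane)) ≤ r / 4 :=
      (Metric.infDist_le_dist_of_mem (Set.mem_insert _ _)).trans hd
    have u2 : Metric.infDist x S ≤ Metric.infDist (seg p q t) S + dist x (seg p q t) :=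
      Metric.infDist_le_infDist_add_dist
    rw [dist_comm] at u2
    have u3 : 3 / 4 * r ≤ Metric.infDist (seg p q t) S := by linarith
    have u4 := Metric.infDist_nonneg (x := seg p q t) (s := insert x (S : Set Plane))
    nlinarith
  have h1 : ∫ _ in Set.Icc c (c + s), r ^ 2 / 2 = s * (r ^ 2 / 2) := by
    simp [hspos.le]
  have h2 : ∫ _ in Set.Icc c (c + s), r ^ 2 / 2
      ≤ ∫ t in Set.Icc c (c + s), (Metric.infDist (seg p q t) S ^ 2
        - Metric.infDist (seg p q t) (insert x (S : Set Plane)) ^ 2) :=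
    setIntegral_mono_on (by simp) ((hint _ _ _).sub (hint _ _ _)) measurableSet_Icc hgain
  have h3 : ∫ t in Set.Icc c (c + s), (Metric.infDist (seg p q t) S ^ 2
        - Metric.infDist (seg p q t) (insert x (S : Set Plane)) ^ 2)
      ≤ ∫ t in Set.Icc (0 : ℝ) 1, (Metric.infDist (seg p q t) S ^ 2
        - Metric.infDist (seg p q t) (insert x (S : Set Plane)) ^ 2) := by
    refine setIntegral_mono_set ((hint _ _ _).sub (hint _ _ _)) ?_
      (Set.Icc_subset_Icc hc0 hc1).eventuallyLE
    refine Eventually.of_forall fun t => sub_nonneg.2 ?_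
    exact pow_le_pow_left₀ Metric.infDist_nonneg
      (Metric.infDist_le_infDist_of_subset (Set.subset_insert _ _) (by simpa using hS)) 2
  rw [integral_sub (hint _ 0 1) (hint _ 0 1)] at h3
  linarith

lemma vertices_nonempty {k : ℕ} (hk : 3 ≤ k) : (vertices k).Nonempty :=
  ⟨vertex k 1, 1, ⟨le_rfl, by omega⟩, rfl⟩

lemma encard_vertices_le (k : ℕ) : (vertices k).encard ≤ k := by
  refine (Set.encard_image_le _ _).trans ?_
  rw [← Finset.coe_Icc, Set.encard_coe_eq_coe_finsetCard]
  simp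

lemma condError_le {P : Measure Plane} {β α : Set Plane} {n : ℕ}
    (h : α.encard + β.encard ≤ n) : condError P β n ≤ distortion P (α ∪ β) := by
  refine csInf_le ⟨0, ?_⟩ ⟨α, h, rfl⟩
  rintro v ⟨α', _, rfl⟩
  exact integral_nonneg fun x => sq_nonneg _

lemma le_condError {P : Measure Plane} {β : Set Plane} {n : ℕ} {b : ℝ} (hβ : β.encard ≤ n)
    (h : ∀ α : Set Plane, α.encard + β.encard ≤ n → b ≤ distortion P (α ∪ β)) :
    b ≤ condError P β n := by
  refine le_csInf ⟨_, ∅, by simpa using hβ, rfl⟩ ?_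
  rintro v ⟨α, hα, rfl⟩
  exact h α hα

/-- An admissible set of points as a finite set. -/
lemma exists_finset_eq_union {α β : Set Plane} {n : ℕ} (h : α.encard + β.encard ≤ n) :
    ∃ S : Finset Plane, (S : Set Plane) = α ∪ β ∧ S.card ≤ n := by
  have h1 : (α ∪ β).encard ≤ n := (Set.encard_union_le _ _).trans h
  have hfin : (α ∪ β).Finite := Set.finite_of_encard_le_coe h1
  refine ⟨hfin.toFinset, hfin.coe_toFinset, ?_⟩
  rw [hfin.encard_eq_coe_toFinset_card] at h1
  exact_mod_cast h1

lemma condError_succ_lt {k : ℕ} (hk : 3 ≤ k) {c : ENNReal} (hc0 : c ≠ 0) (hc : c ≠ ⊤) {n : ℕ}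
    (hn : (vertices k).encard ≤ n) :
    condError (c • arcLength k) (vertices k) (n + 1) <
      condError (c • arcLength k) (vertices k) n := by
  have hn0 : 0 < n := by
    have h1 := Set.encard_pos.2 (vertices_nonempty hk)
    exact_mod_cast h1.trans_le hn
  have hn' : (0 : ℝ) < n := by exact_mod_cast hn0
  have hcpos := ENNReal.toReal_pos hc0 hc
  have hs := sin_pi_div_pos hk
  have hpq : vertex k 1 ≠ vertex k (1 + 1) := by
    rw [← dist_pos, dist_vertex_succ hk]; positivity
  have hlen : 0 < dist (vertex k 1) (vertex k (1 + 1)) := dist_pos.2 hpq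
  set ε := 1 / (16 * (n : ℝ)) * ((dist (vertex k 1) (vertex k (1 + 1)) / (4 * n)) ^ 2 / 2) with hε
  have hεpos : 0 < ε := by positivity
  have key : condError (c • arcLength k) (vertices k) (n + 1)
        + c.toReal * (2 * Real.sin (Real.pi / k) * ε)
      ≤ condError (c • arcLength k) (vertices k) n := by
    refine le_condError hn fun α hα => ?_
    obtain ⟨S, hS, hcard⟩ := exists_finset_eq_union hα
    have hne : (α ∪ vertices k).Nonempty := (vertices_nonempty hk).inr
    have hSne : S.Nonempty := by rw [← Finset.coe_nonempty, hS]; exact hne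
    obtain ⟨x, hx⟩ := exists_insert_integral_le hpq hn0 S hSne hcard
    rw [hS, ← hε] at hx
    have h1 : condError (c • arcLength k) (vertices k) (n + 1)
        ≤ distortion (c • arcLength k) (insert x α ∪ vertices k) := by
      apply condError_le
      calc _ ≤ α.encard + 1 + (vertices k).encard := by gcongr; exact Set.encard_insert_le _ _
        _ = α.encard + (vertices k).encard + 1 := by ring
        _ ≤ _ := by push_cast; gcongr
    have h2 : sideError k (insert x α ∪ vertices k) + ε ≤ sideError k (α ∪ vertices k) := by
      have h1k : 1 ∈ Finset.Icc 1 k := Finset.mem_Icc.2 ⟨le_rfl, by omega⟩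
      rw [Set.insert_union]
      unfold sideError
      rw [← Finset.add_sum_erase _ _ h1k, ← Finset.add_sum_erase _ _ h1k]
      have := Finset.sum_le_sum fun j (_ : j ∈ (Finset.Icc 1 k).erase 1) =>
        setIntegral_infDist_sq_mono (vertex k j) (vertex k (j + 1)) hne
          (Set.subset_insert x (α ∪ vertices k)) 0 1
      linarith
    rw [distortion_smul_arcLength hk] at h1 ⊢
    calc _ ≤ c.toReal * (2 * Real.sin (Real.pi / k) * sideError k (insert x α ∪ vertices k))
          + c.toReal * (2 * Real.sin (Real.pi / k) * ε) := by gcongr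
      _ = c.toReal * (2 * Real.sin (Real.pi / k) *
          (sideError k (insert x α ∪ vertices k) + ε)) := by ring
      _ ≤ _ := by gcongr
  have : 0 < c.toReal * (2 * Real.sin (Real.pi / k) * ε) := by positivity
  linarith

lemma strictAntiOn_condError {k : ℕ} (hk : 3 ≤ k) {c : ENNReal} (hc0 : c ≠ 0) (hc : c ≠ ⊤) :
    StrictAntiOn (condError (c • arcLength k) (vertices k))
      {n : ℕ | (vertices k).encard ≤ (n : ℕ∞)} := by
  intro m hm n _ hmn
  have hm' : (vertices k).encard ≤ (m : ℕ∞) := hm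
  induction n, Nat.succ_le_of_lt hmn using Nat.le_induction with
  | base => exact condError_succ_lt hk hc0 hc hm'
  | succ n hmn' ih =>
    have hle : (m : ℕ∞) ≤ n := by exact_mod_cast (Nat.le_of_succ_le hmn')
    exact (condError_succ_lt hk hc0 hc (hm'.trans hle)).trans (ih (hm'.trans hle) hmn')

/-! ### Asymptotics of the errors -/

/-- The asymptotic lower bound that comes from the sides without their parts near the vertices. -/
lemma eventually_le_sq_mul_condError {k : ℕ} (hk : 3 ≤ k) {c : ENNReal} {δ : ℝ} (hδ : 0 < δ)
    (hδ' : δ < 1 / 2) :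
    ∀ᶠ n : ℕ in atTop, c.toReal * (k * (2 * Real.sin (Real.pi / k)) * (1 - 2 * δ)) ^ 3 / 12 ≤
      (n : ℝ) ^ 2 * condError (c • arcLength k) (vertices k) n := by
  have hs := sin_pi_div_pos hk
  have hk0 : (0 : ℝ) < k := by positivity
  have hgap := normalGap_pos hk
  set l := 2 * Real.sin (Real.pi / k) with hl
  set T := k * l * (1 - 2 * δ) with hT
  have hlpos : 0 < l := by positivity
  have hTpos : 0 < T := mul_pos (by positivity) (by linarith)
  have hlim : Tendsto (fun n : ℕ => T / n) atTop (𝓝 0) :=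
    tendsto_const_div_atTop_nhds_zero_nat T
  filter_upwards [eventually_ge_atTop k, hlim.eventually_le_const (mul_pos hδ hgap)] with n hn hTn
  have hn' : (0 : ℝ) < n := by
    have : (k : ℝ) ≤ n := by exact_mod_cast hn
    linarith
  have hV : c.toReal * (T ^ 3 / (12 * n ^ 2)) ≤ condError (c • arcLength k) (vertices k) n := by
    refine le_condError ((encard_vertices_le k).trans (by exact_mod_cast hn)) fun α hα => ?_
    obtain ⟨S, hS, hcard⟩ := exists_finset_eq_union hα
    have hne : (α ∪ vertices k).Nonempty := (vertices_nonempty hk).inr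
    have hSne : S.Nonempty := by rw [← Finset.coe_nonempty, hS]; exact hne
    have hcard' : (S.card : ℝ) ≤ n := by exact_mod_cast hcard
    rw [distortion_smul_arcLength hk, ← hl, ← hS]
    gcongr
    -- the radius `T / (2 * n)` maximizes `T * h ^ 2 - n * (4 / 3 * h ^ 3)`
    have h1 := le_sum_integral_infDist_sq (Finset.Icc 1 k) (fun j => vertex k j)
      (fun j => vertex k (j + 1)) hlpos (fun j _ => dist_vertex_succ hk j)
      (a := δ) (b := 1 - δ) (h := T / (2 * n)) (by linarith) (by positivity)
      (fun x i hi j hj s hs t _ hx hy => side_eq_of_dist_lt hk hi hj hδ.le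
        (by rw [show 2 * (T / (2 * n)) = T / n by field_simp]; exact hTn) hs hx hy) S hSne
    have h2 : ∑ j ∈ Finset.Icc 1 k, ∫ t in Set.Icc δ (1 - δ),
          Metric.infDist (seg (vertex k j) (vertex k (j + 1)) t) S ^ 2 ≤ sideError k S := by
      refine Finset.sum_le_sum fun j _ => setIntegral_mono_set ?_ ?_ ?_
      · exact (continuous_infDist_seg _ _ _).continuousOn.integrableOn_compact isCompact_Icc
      · exact Eventually.of_forall fun t => sq_nonneg _
      · exact (Set.Icc_subset_Icc hδ.le (by linarith)).eventuallyLE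
    refine le_trans ?_ (h1.trans (by gcongr))
    rw [Nat.card_Icc, Nat.add_sub_cancel]
    calc T ^ 3 / (12 * n ^ 2) = T * (T / (2 * n)) ^ 2 - n * (4 / 3 * (T / (2 * n)) ^ 3) := by
          field_simp; ring
      _ = k * (l * (1 - δ - δ)) * (T / (2 * n)) ^ 2 - n * (4 / 3 * (T / (2 * n)) ^ 3) := by
          rw [hT]; ring
      _ ≤ _ := by gcongr
  calc _ = (n : ℝ) ^ 2 * (c.toReal * (T ^ 3 / (12 * n ^ 2))) := by field_simp
    _ ≤ _ := by gcongr

/-- The error of the points that divide each side into `m` equal parts. -/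
lemma condError_le_of_mul_le {k : ℕ} (hk : 3 ≤ k) (c : ENNReal) {m n : ℕ} (hm : 0 < m)
    (hmn : k * m ≤ n) :
    condError (c • arcLength k) (vertices k) n ≤
      c.toReal * (k * (2 * Real.sin (Real.pi / k)) ^ 3 / (12 * m ^ 2)) := by
  classical
  have hs := sin_pi_div_pos hk
  have hm' : (0 : ℝ) < m := by exact_mod_cast hm
  set S : Finset Plane := (Finset.Icc 1 k ×ˢ Finset.Icc 1 (m - 1)).image
    fun ji => seg (vertex k ji.1) (vertex k (ji.1 + 1)) ((ji.2 : ℝ) / m) with hS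
  have hScard : S.card ≤ k * (m - 1) := by
    refine Finset.card_image_le.trans ?_
    simp
  have hadm : (S : Set Plane).encard + (vertices k).encard ≤ n := by
    calc _ ≤ ((k * (m - 1) : ℕ) : ℕ∞) + k := by
          gcongr
          · rw [Set.encard_coe_eq_coe_finsetCard]; exact_mod_cast hScard
          · exact encard_vertices_le k
      _ = ((k * m : ℕ) : ℕ∞) := by
          norm_cast
          rw [← Nat.mul_succ, Nat.succ_eq_add_one, Nat.sub_add_cancel hm]
      _ ≤ _ := by exact_mod_cast hmn
  refine (condError_le hadm).trans ?_
  have hgrid : ∀ j ∈ Finset.Icc 1 k, ∀ i ≤ m,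
      seg (vertex k j) (vertex k (j + 1)) ((i : ℝ) / m) ∈ (S : Set Plane) ∪ vertices k := by
    intro j hj i hi
    rcases Nat.eq_zero_or_pos i with rfl | hi0
    · right
      rw [Finset.mem_Icc] at hj
      have hmem : vertex k j ∈ vertices k := ⟨j, hj, rfl⟩
      simpa [seg] using hmem
    rcases hi.eq_or_lt with rfl | him
    · right
      simpa [seg, hm'.ne'] using vertex_succ_mem_vertices hk hj
    · left
      rw [hS]
      exact Finset.mem_coe.2 (Finset.mem_image.2 ⟨(j, i), Finset.mem_product.2
        ⟨hj, Finset.mem_Icc.2 ⟨hi0, by omega⟩⟩, rfl⟩)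
  have hside : sideError k (S ∪ vertices k) ≤
      k * ((2 * Real.sin (Real.pi / k)) ^ 2 / (12 * m ^ 2)) := by
    have : ∀ j ∈ Finset.Icc 1 k, ∫ t in Set.Icc (0 : ℝ) 1,
        Metric.infDist (seg (vertex k j) (vertex k (j + 1)) t) (S ∪ vertices k) ^ 2
        ≤ (2 * Real.sin (Real.pi / k)) ^ 2 / (12 * m ^ 2) := by
      intro j hj
      refine integral_le_of_le_sq_grid (continuous_infDist_seg _ _ _) hm fun t i hi => ?_
      have := Metric.infDist_le_dist_of_mem
        (x := seg (vertex k j) (vertex k (j + 1)) t) (hgrid j hj i hi)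
      rw [dist_seg_seg, dist_vertex_succ hk] at this
      calc _ ≤ (2 * Real.sin (Real.pi / k) * |t - i / m|) ^ 2 :=
            pow_le_pow_left₀ Metric.infDist_nonneg this 2
        _ = _ := by rw [mul_pow, sq_abs, ← mul_pow]
    have h := Finset.sum_le_sum this
    rwa [Finset.sum_const, Nat.card_Icc, Nat.add_sub_cancel, nsmul_eq_mul] at h
  rw [distortion_smul_arcLength hk]
  gcongr
  calc _ ≤ 2 * Real.sin (Real.pi / k) *
        (k * ((2 * Real.sin (Real.pi / k)) ^ 2 / (12 * m ^ 2))) := by gcongr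
    _ = _ := by ring

lemma tendsto_sq_mul_condError {k : ℕ} (hk : 3 ≤ k) (c : ENNReal) :
    Tendsto (fun n : ℕ => (n : ℝ) ^ 2 * condError (c • arcLength k) (vertices k) n) atTop
      (𝓝 (c.toReal * (k * (2 * Real.sin (Real.pi / k))) ^ 3 / 12)) := by
  have hs := sin_pi_div_pos hk
  have hk0 : (0 : ℝ) < k := by positivity
  set l := 2 * Real.sin (Real.pi / k) with hl
  refine tendsto_order.2 ⟨fun a ha => ?_, fun a ha => ?_⟩
  · have hcont : Tendsto (fun δ : ℝ => c.toReal * (k * l * (1 - 2 * δ)) ^ 3 / 12) (𝓝[>] 0)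
        (𝓝 (c.toReal * (k * l) ^ 3 / 12)) := by
      have : Continuous fun δ : ℝ => c.toReal * (k * l * (1 - 2 * δ)) ^ 3 / 12 := by fun_prop
      have h := (this.tendsto 0).mono_left (nhdsWithin_le_nhds (s := Set.Ioi 0))
      simpa using h
    obtain ⟨δ, h1, hδ, hδ'⟩ := ((hcont.eventually_const_lt ha).and
      (Ioo_mem_nhdsGT (show (0 : ℝ) < 1 / 2 by norm_num))).exists
    filter_upwards [eventually_le_sq_mul_condError (c := c) hk hδ hδ'] with n hn
    exact h1.trans_le hn
  · have hdiv : Tendsto (fun n : ℕ => n / k) atTop atTop :=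
      Nat.tendsto_div_const_atTop (by omega)
    have hlim : Tendsto (fun m : ℕ => (k * (1 + 1 / (m : ℝ))) ^ 2 * (c.toReal * (k * l ^ 3 / 12)))
        atTop (𝓝 (c.toReal * (k * l) ^ 3 / 12)) := by
      have h := (((tendsto_one_div_atTop_nhds_zero_nat (𝕜 := ℝ)).const_add 1).const_mul
        (k : ℝ)).pow 2 |>.mul_const (c.toReal * (k * l ^ 3 / 12))
      convert h using 2
      ring
    filter_upwards [(hlim.comp hdiv).eventually_lt_const ha, hdiv.eventually_ge_atTop 1]
      with n hn hm
    refine lt_of_le_of_lt ?_ hn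
    simp only [Function.comp_apply]
    have hm' : (0 : ℝ) < (n / k : ℕ) := by exact_mod_cast hm
    have hV := condError_le_of_mul_le hk c hm (Nat.mul_div_le n k)
    have hnm : (n : ℝ) ≤ k * ((n / k : ℕ) + 1) := by
      exact_mod_cast (Nat.lt_mul_div_succ n (by omega : 0 < k)).le
    calc _ ≤ (n : ℝ) ^ 2 * (c.toReal * (k * l ^ 3 / (12 * (n / k : ℕ) ^ 2))) := by gcongr
      _ ≤ (k * (((n / k : ℕ) : ℝ) + 1)) ^ 2 *
          (c.toReal * (k * l ^ 3 / (12 * (n / k : ℕ) ^ 2))) := by gcongr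
      _ = _ := by field_simp

/-- An error of order exactly `1 / n ^ 2` has quantization dimension `1`. -/
lemma tendsto_log_div_neg_log {V : ℕ → ℝ} {C : ℝ} (hC : 0 < C)
    (hV : Tendsto (fun n : ℕ => (n : ℝ) ^ 2 * V n) atTop (𝓝 C)) :
    Tendsto (fun n : ℕ => 2 * Real.log n / (-Real.log (V n))) atTop (𝓝 1) := by
  have hlogn : Tendsto (fun n : ℕ => 2 * Real.log n) atTop atTop :=
    (Real.tendsto_log_atTop.comp tendsto_natCast_atTop_atTop).const_mul_atTop two_pos
  have h1 : Tendsto (fun n : ℕ => Real.log ((n : ℝ) ^ 2 * V n) / (2 * Real.log n)) atTop (𝓝 0) :=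
    (hV.log hC.ne').div_atTop hlogn
  have h2 : Tendsto (fun n : ℕ => (1 - Real.log ((n : ℝ) ^ 2 * V n) / (2 * Real.log n))⁻¹) atTop
      (𝓝 1) := by
    simpa using (h1.const_sub 1).inv₀ (by norm_num)
  refine h2.congr' ?_
  filter_upwards [hlogn.eventually_gt_atTop 0, hV.eventually_const_lt hC,
    eventually_gt_atTop 0] with n hn hpos hn0
  have hn' : (n : ℝ) ≠ 0 := by positivity
  have hVn : V n ≠ 0 := by rintro h; simp [h] at hpos
  rw [Real.log_mul (by positivity) hVn, Real.log_pow, ← inv_div (-Real.log (V n))]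
  congr 1
  have hlog : Real.log n ≠ 0 := by rintro h; simp [h] at hn
  field_simp
  push_cast
  ring

lemma tendsto_zero_of_tendsto_sq_mul {V : ℕ → ℝ} {C : ℝ}
    (hV : Tendsto (fun n : ℕ => (n : ℝ) ^ 2 * V n) atTop (𝓝 C)) : Tendsto V atTop (𝓝 0) := by
  have h : Tendsto (fun n : ℕ => (n : ℝ) ^ 2) atTop atTop :=
    (tendsto_pow_atTop two_ne_zero).comp tendsto_natCast_atTop_atTop
  refine (hV.div_atTop h).congr' ?_
  filter_upwards [eventually_gt_atTop 0] with n hn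
  have hn' : (n : ℝ) ≠ 0 := by positivity
  field_simp

lemma hasCondQuant_smul_arcLength {k : ℕ} (hk : 3 ≤ k) {c : ENNReal} (hc0 : c ≠ 0) (hc : c ≠ ⊤) :
    HasCondQuantDim (c • arcLength k) (vertices k) 1 ∧
      HasCondQuantCoeff (c • arcLength k) (vertices k) 1
        (c.toReal * (k * (2 * Real.sin (Real.pi / k))) ^ 3 / 12) := by
  have hlim := tendsto_sq_mul_condError hk c
  have hzero := tendsto_zero_of_tendsto_sq_mul hlim
  have hpos : 0 < c.toReal * (k * (2 * Real.sin (Real.pi / k))) ^ 3 / 12 := by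
    have := sin_pi_div_pos hk
    have := ENNReal.toReal_pos hc0 hc
    positivity
  refine ⟨⟨strictAntiOn_condError hk hc0 hc, 0, hzero, ?_⟩, 0, hzero, ?_⟩
  · simpa using tendsto_log_div_neg_log hpos hlim
  · simpa using hlim

end CondQuantization

theorem mainTheorem2 (k : ℕ) (hk : 3 ≤ k) :
    (CondQuantization.HasCondQuantDim
        (CondQuantization.polygonMeasure k) (CondQuantization.vertices k) 1 ∧
      CondQuantization.HasCondQuantCoeff
        (CondQuantization.polygonMeasure k) (CondQuantization.vertices k) 1
        (2 / 3 * (k : ℝ) ^ 2 * Real.sin (Real.pi / k) ^ 3) ∧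
      0 < 2 / 3 * (k : ℝ) ^ 2 * Real.sin (Real.pi / k) ^ 3) ∧
    (CondQuantization.HasCondQuantDim
        (CondQuantization.uniformProb k) (CondQuantization.vertices k) 1 ∧
      CondQuantization.HasCondQuantCoeff
        (CondQuantization.uniformProb k) (CondQuantization.vertices k) 1
        (1 / 3 * (k : ℝ) ^ 2 * Real.sin (Real.pi / k) ^ 2) ∧
      0 < 1 / 3 * (k : ℝ) ^ 2 * Real.sin (Real.pi / k) ^ 2) := by
  have hs := CondQuantization.sin_pi_div_pos hk
  have hk0 : (0 : ℝ) < k := by positivity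
  have harc := CondQuantization.arcLength_univ hk
  have hperim : (0 : ℝ) < k * (2 * Real.sin (Real.pi / k)) := by positivity
  have h1 := CondQuantization.hasCondQuant_smul_arcLength hk (c := (k : ENNReal)⁻¹)
    (by simp) (by simp; omega)
  have h2 := CondQuantization.hasCondQuant_smul_arcLength hk
    (c := (CondQuantization.arcLength k Set.univ)⁻¹)
    (by rw [harc]; exact ENNReal.inv_ne_zero.2 ENNReal.ofReal_ne_top)
    (by rw [harc, ENNReal.inv_ne_top]; exact (ENNReal.ofReal_pos.2 hperim).ne')
  have e1 : ((k : ENNReal)⁻¹).toReal * (k * (2 * Real.sin (Real.pi / k))) ^ 3 / 12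
      = 2 / 3 * (k : ℝ) ^ 2 * Real.sin (Real.pi / k) ^ 3 := by
    rw [ENNReal.toReal_inv, ENNReal.toReal_natCast]
    field_simp
    norm_num
  have e2 : ((CondQuantization.arcLength k Set.univ)⁻¹).toReal
        * (k * (2 * Real.sin (Real.pi / k))) ^ 3 / 12
      = 1 / 3 * (k : ℝ) ^ 2 * Real.sin (Real.pi / k) ^ 2 := by
    rw [harc, ENNReal.toReal_inv, ENNReal.toReal_ofReal hperim.le]
    field_simp
    norm_num
  rw [e1] at h1
  rw [e2] at h2
  exact ⟨⟨h1.1, h1.2, by positivity⟩, h2.1, h2.2, by positivity⟩
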